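/- For $\xi\in\mathbb R$ let $g_\xi(x)=e^{2\pi i\xi x}$ and let $\mathcal F(g_\xi)=(\varphi_n)_{n\in\mathbb Z}$ be the family in $L^2[-1/2,1/2]$ given by $\varphi_n(x)=e^{2\pi i n x}$ for $n\ge 0$ and $\varphi_n(x)=g_\xi(x)e^{2\pi i n x}=e^{2\pi i(\xi+n)x}$ for $n<0$ (a family indexed by $\mathbb Z$: a function that occurs for two indices is counted twice). The family is called complete if $f\in L^2[-1/2,1/2]$ and $\langle f,\varphi_n\rangle=0$ for all $n$ imply $f=0$; a frame if there are constants $0<A\le B<\infty$ with $A\|f\|^2\le\sum_{n\in\mathbb Z}|\langle f,\varphi_n\rangle|^2\le B\|f\|^2$ for all $f\in L^2[-1/2,1/2]$; and a Riesz basis if it is a frame and every $f\in L^2[-1/2,1/2]$ has a unique expansion $f=\sum_{n\in\mathbb Z}\alpha_n\varphi_n$ with $\alpha_n\in\mathbb C$, the series converging unconditionally in $L^2$. Then: - If $\xi<-1/2$, then $\mathcal F(g_\xi)$ is incomplete (not complete). - If $-1/2<\xi<1/2$, then $\mathcal F(g_\xi)$ is a Riesz basis. - If $-1/2+n<\xi<1/2+n$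 for some integer $n\ge 1$, then $\mathcal F(g_\xi)$ is a frame but not a Riesz basis. - If $\xi=-1/2+n$ for some integer $n\ge 0$, then $\mathcal F(g_\xi)$ is complete, but it is neither a frame nor a Riesz basis. -/

import Mathlib

open MeasureTheory

noncomputable section

namespace WindowedExp

section Hilbert

variable {ι H : Type*} [NormedAddCommGroup H] [InnerProductSpace ℂ H]

/-- A family of vectors is complete if only the zero vector is orthogonal to all its members. -/
def IsCompleteFamily (φ : ι → H) : Prop :=
  ∀ f : H, (∀ i, inner ℂ (φ i) f = 0) → f = 0

/-- A frame: `A ‖f‖² ≤ ∑ |⟨f, φ i⟩|² ≤ B ‖f‖²` for all `f`, with constants `0 < A ≤ B < ∞`. -/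
def IsFrame (φ : ι → H) : Prop :=
  ∃ A B : ℝ, 0 < A ∧ A ≤ B ∧ ∀ f : H,
    Summable (fun i => ‖inner ℂ (φ i) f‖ ^ 2) ∧
    A * ‖f‖ ^ 2 ≤ ∑' i, ‖inner ℂ (φ i) f‖ ^ 2 ∧
    ∑' i, ‖inner ℂ (φ i) f‖ ^ 2 ≤ B * ‖f‖ ^ 2

/-- A Riesz basis: a frame for which every vector has exactly one expansion
`f = ∑ α i • φ i`, the series converging unconditionally in norm. -/
def IsRieszBasis (φ : ι → H) : Prop :=
  IsFrame φ ∧ ∀ f : H, ∃! α : ι → ℂ, HasSum (fun i => α i • φ i) f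

end Hilbert

/-- Lebesgue measure on `[-1/2, 1/2]`. -/
abbrev μI : Measure ℝ := volume.restrict (Set.Icc (-1 / 2 : ℝ) (1 / 2))

/-- The Hilbert space `L²[-1/2, 1/2]` of complex-valued functions. -/
abbrev L2I : Type := Lp ℂ 2 μI

/-- The exponential `x ↦ e^{2πiξx}`. -/
def expFun (ξ : ℝ) (x : ℝ) : ℂ := Complex.exp (2 * Real.pi * Complex.I * ξ * x)

theorem continuous_expFun (ξ : ℝ) : Continuous (expFun ξ) := by
  unfold expFun; fun_prop

theorem norm_expFun (ξ x : ℝ) : ‖expFun ξ x‖ = 1 := by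
  have h : (2 * Real.pi * Complex.I * ξ * x : ℂ)
      = ((2 * Real.pi * ξ * x : ℝ) : ℂ) * Complex.I := by
    push_cast; ring
  rw [expFun, h, Complex.norm_exp_ofReal_mul_I]

theorem memLp_mul_expFun {g : ℝ → ℂ} (hg : MemLp g 2 μI) (t : ℝ) :
    MemLp (fun x => g x * expFun t x) 2 μI := by
  refine hg.of_le (hg.1.mul (continuous_expFun t).aestronglyMeasurable) ?_
  filter_upwards with x
  rw [norm_mul, norm_expFun, mul_one]

theorem memLp_expFun (ξ : ℝ) : MemLp (expFun ξ) 2 μI := by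
  refine MemLp.of_bound (continuous_expFun ξ).aestronglyMeasurable 1 ?_
  filter_upwards with x
  rw [norm_expFun]

theorem memLp_one : MemLp (fun _ : ℝ => (1 : ℂ)) 2 μI := memLp_const 1

/-- The windowed exponential `g(x) e^{2πitx}` as an element of `L²[-1/2, 1/2]`. -/
def windowedExp (g : ℝ → ℂ) (hg : MemLp g 2 μI) (t : ℝ) : L2I :=
  (memLp_mul_expFun hg t).toLp (fun x => g x * expFun t x)

/-- The system `𝓕(g) = {e^{2πinx} : n ≥ 0} ∪ {g(x) e^{2πinx} : n < 0}`, as a family indexed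
by `n ∈ ℤ` (so that functions occurring twice are counted twice). -/
def system (g : ℝ → ℂ) (hg : MemLp g 2 μI) (n : ℤ) : L2I :=
  if 0 ≤ n then windowedExp (fun _ => 1) memLp_one n else windowedExp g hg n

/-- The system `𝓕(g_ξ)` for the window `g_ξ(x) = e^{2πiξx}`. -/
def expSystem (ξ : ℝ) : ℤ → L2I := system (expFun ξ) (memLp_expFun ξ)

end WindowedExp

end

noncomputable section

namespace WindowedExp

/-! ### Modulation operators on `L²[-1/2, 1/2]` -/

/-! Let `P` be the projection onto nonnegative frequencies and `M t` multiplication by `e^{2πitx}`.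
By Parseval the frame sum of `f` is `‖T f‖²` with `T f = P f + (1 - P) M (-ξ) f` (`analysis`), so
completeness is injectivity of `T`, and the frame property is a lower bound for `T`.

For `|ξ| < 1/2`, `Re e^{2πiξx} ≥ cos πξ > 0` on the interval. This coercivity bounds both `T` and
its adjoint from below, so the adjoint is an isomorphism carrying the Fourier basis to the system.
At `ξ = -1/2` only strict positivity a.e. survives, which still gives injectivity.

Passing from `ξ` to `ξ + 1` amounts, up to modulation, to adding one vector. This preserves
completeness, frames and existence of expansions, but destroys uniqueness. Conversely, removing one
vector from a frame leaves a frame if the rest is complete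
(`bounded_below_of_bounded_below_add_inner`).

For `ξ < -1/2` a function `(cos πx)^p e^{2πitx}` is orthogonal to the whole system. Since the frame
property is open in `ξ`, it fails at `-1/2`, and by removing vectors at every `-1/2 + n`. -/

theorem expFun_add (s t x : ℝ) : expFun (s + t) x = expFun s x * expFun t x := by
  rw [expFun, expFun, expFun, ← Complex.exp_add]
  push_cast
  ring_nf

theorem expFun_zero (x : ℝ) : expFun 0 x = 1 := by simp [expFun]

theorem conj_expFun (t x : ℝ) : starRingEnd ℂ (expFun t x) = expFun (-t) x := by
  rw [expFun, expFun, ← Complex.exp_conj]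
  simp [Complex.conj_ofNat]

theorem re_expFun (t x : ℝ) : (expFun t x).re = Real.cos (2 * Real.pi * t * x) := by
  have h : (2 * Real.pi * Complex.I * t * x : ℂ)
      = ((2 * Real.pi * t * x : ℝ) : ℂ) * Complex.I := by
    push_cast; ring
  rw [expFun, h, Complex.exp_ofReal_mul_I_re]

theorem norm_expFun_sub_le (s t x : ℝ) :
    ‖expFun s x - expFun t x‖ ≤ 2 * Real.pi * |s - t| * |x| := by
  have h1 : expFun s x = expFun t x * expFun (s - t) x := by
    rw [← expFun_add]; ring_nf
  have h2 : (2 * Real.pi * Complex.I * (s - t : ℝ) * x : ℂ)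
      = Complex.I * ((2 * Real.pi * (s - t) * x : ℝ) : ℂ) := by
    push_cast; ring
  rw [h1, ← mul_sub_one, norm_mul, norm_expFun, one_mul, expFun, h2]
  refine (Real.norm_exp_I_mul_ofReal_sub_one_le).trans_eq ?_
  rw [Real.norm_eq_abs, abs_mul, abs_mul, abs_of_pos Real.two_pi_pos]

/-- Multiplication by `e^{2πitx}` on `L²[-1/2, 1/2]`. -/
def mulExp (t : ℝ) : L2I →ₗᵢ[ℂ] L2I where
  toFun f := windowedExp f (Lp.memLp f) t
  map_add' f g := by
    refine Lp.ext ?_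
    filter_upwards [MemLp.coeFn_toLp (memLp_mul_expFun (Lp.memLp (f + g)) t),
      MemLp.coeFn_toLp (memLp_mul_expFun (Lp.memLp f) t),
      MemLp.coeFn_toLp (memLp_mul_expFun (Lp.memLp g) t),
      Lp.coeFn_add (windowedExp f (Lp.memLp f) t) (windowedExp g (Lp.memLp g) t),
      Lp.coeFn_add f g] with x h1 h2 h3 h4 h5
    rw [h4, Pi.add_apply]
    simp only [windowedExp, h1, h2, h3, h5, Pi.add_apply, add_mul]
  map_smul' c f := by
    refine Lp.ext ?_
    filter_upwards [MemLp.coeFn_toLp (memLp_mul_expFun (Lp.memLp (c • f)) t),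
      MemLp.coeFn_toLp (memLp_mul_expFun (Lp.memLp f) t),
      Lp.coeFn_smul c (windowedExp f (Lp.memLp f) t),
      Lp.coeFn_smul c f] with x h1 h2 h4 h5
    rw [RingHom.id_apply, h4, Pi.smul_apply]
    simp only [windowedExp, h1, h2, h5, Pi.smul_apply, smul_eq_mul, mul_assoc]
  norm_map' f := by
    change ‖windowedExp f (Lp.memLp f) t‖ = ‖f‖
    rw [windowedExp, Lp.norm_toLp, Lp.norm_def]
    congr 1
    refine eLpNorm_congr_norm_ae ?_
    filter_upwards with x
    rw [norm_mul, norm_expFun, mul_one]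

theorem coeFn_mulExp (t : ℝ) (f : L2I) : mulExp t f =ᵐ[μI] fun x => f x * expFun t x :=
  MemLp.coeFn_toLp (memLp_mul_expFun (Lp.memLp f) t)

theorem coeFn_windowedExp (g : ℝ → ℂ) (hg : MemLp g 2 μI) (t : ℝ) :
    windowedExp g hg t =ᵐ[μI] fun x => g x * expFun t x :=
  MemLp.coeFn_toLp (memLp_mul_expFun hg t)

theorem mulExp_mulExp (s t : ℝ) (f : L2I) : mulExp s (mulExp t f) = mulExp (s + t) f := by
  refine Lp.ext ?_
  filter_upwards [coeFn_mulExp s (mulExp t f), coeFn_mulExp t f, coeFn_mulExp (s + t) f]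
    with x h1 h2 h3
  rw [h1, h2, h3, expFun_add]
  ring

theorem mulExp_zero (f : L2I) : mulExp 0 f = f := by
  refine Lp.ext ?_
  filter_upwards [coeFn_mulExp 0 f] with x h1
  rw [h1, expFun_zero, mul_one]

theorem mulExp_mulExp_neg (t : ℝ) (f : L2I) : mulExp t (mulExp (-t) f) = f := by
  rw [mulExp_mulExp, add_neg_cancel, mulExp_zero]

theorem inner_mulExp_left (t : ℝ) (f g : L2I) :
    inner ℂ (mulExp t f) g = inner ℂ f (mulExp (-t) g) := by
  rw [L2.inner_def, L2.inner_def]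
  refine integral_congr_ae ?_
  filter_upwards [coeFn_mulExp t f, coeFn_mulExp (-t) g] with x h1 h2
  rw [h1, h2, RCLike.inner_apply, RCLike.inner_apply, map_mul, conj_expFun]
  ring

/-- Lipschitz dependence on the frequency is what makes the frame property open in `ξ`; the factor
`2π|x|` is at most `π` here. -/
theorem norm_mulExp_sub_le (s t : ℝ) (f : L2I) :
    ‖mulExp s f - mulExp t f‖ ≤ Real.pi * |s - t| * ‖f‖ := by
  refine Lp.norm_le_mul_norm_of_ae_le_mul ?_
  filter_upwards [coeFn_mulExp s f, coeFn_mulExp t f, Lp.coeFn_sub (mulExp s f) (mulExp t f),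
    ae_restrict_mem measurableSet_Icc] with x h1 h2 h3 hx
  rw [h3, Pi.sub_apply, h1, h2, ← mul_sub, norm_mul, mul_comm]
  have hx' : |x| ≤ 1 / 2 := abs_le.2 ⟨by linarith [hx.1], hx.2⟩
  refine mul_le_mul_of_nonneg_right ((norm_expFun_sub_le s t x).trans ?_) (norm_nonneg _)
  have := mul_le_mul_of_nonneg_left hx' (by positivity : 0 ≤ 2 * Real.pi * |s - t|)
  linarith

/-- `Re ⟨f, e^{2πitx} f⟩ = ∫ cos(2πtx) |f(x)|² dx`. -/
theorem re_inner_mulExp (t : ℝ) (f : L2I) :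
    (inner ℂ f (mulExp t f)).re = ∫ x, Real.cos (2 * Real.pi * t * x) * ‖f x‖ ^ 2 ∂μI := by
  rw [L2.inner_def]
  change RCLike.re (∫ x, inner ℂ (f x) (mulExp t f x) ∂μI) = _
  rw [← integral_re (L2.integrable_inner f (mulExp t f))]
  refine integral_congr_ae ?_
  filter_upwards [coeFn_mulExp t f] with x h1
  simp only [h1, RCLike.inner_apply]
  rw [mul_right_comm, Complex.mul_conj, Complex.normSq_eq_norm_sq]
  change ((((‖f x‖ ^ 2 : ℝ) : ℂ)) * expFun t x).re = _
  rw [Complex.re_ofReal_mul, re_expFun, mul_comm]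

theorem integrable_norm_sq (f : L2I) : Integrable (fun x => ‖f x‖ ^ 2) μI :=
  (Lp.memLp f).integrable_norm_pow (by norm_num)

theorem integrable_cos_mul_norm_sq (t : ℝ) (f : L2I) :
    Integrable (fun x => Real.cos (2 * Real.pi * t * x) * ‖f x‖ ^ 2) μI := by
  refine (integrable_norm_sq f).bdd_mul (c := 1)
    (Continuous.aestronglyMeasurable (by fun_prop)) ?_
  filter_upwards with x
  exact Real.abs_cos_le_one _

theorem norm_sq_eq_integral (f : L2I) : ‖f‖ ^ 2 = ∫ x, ‖f x‖ ^ 2 ∂μI := by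
  have h := re_inner_mulExp 0 f
  rw [mulExp_zero, inner_self_eq_norm_sq_to_K] at h
  simp only [mul_zero, zero_mul, Real.cos_zero, one_mul] at h
  rw [← h]
  norm_cast

/-- Coercivity of multiplication by `e^{2πitx}` for `|t| ≤ 1/2`. -/
theorem cos_mul_norm_sq_le_re_inner {t : ℝ} (ht : |t| ≤ 1 / 2) (f : L2I) :
    Real.cos (Real.pi * t) * ‖f‖ ^ 2 ≤ (inner ℂ f (mulExp t f)).re := by
  rw [re_inner_mulExp, norm_sq_eq_integral, ← integral_const_mul]
  refine integral_mono_ae ((integrable_norm_sq f).const_mul _) (integrable_cos_mul_norm_sq t f) ?_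
  filter_upwards [ae_restrict_mem measurableSet_Icc] with x hx
  refine mul_le_mul_of_nonneg_right ?_ (by positivity)
  have hx' : |x| ≤ 1 / 2 := abs_le.2 ⟨by linarith [hx.1], hx.2⟩
  -- Evenness reduces the claim to monotonicity of cosine on `[0, π]`, with `|2πtx| = π|t| · 2|x|`
  -- and `2|x| ≤ 1`.
  rw [← Real.cos_abs (Real.pi * t), ← Real.cos_abs (2 * Real.pi * t * x)]
  have hpi := Real.pi_pos
  have h1 : |Real.pi * t| = Real.pi * |t| := by rw [abs_mul, abs_of_pos hpi]
  have h2 : |2 * Real.pi * t * x| = (Real.pi * |t|) * (2 * |x|) := by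
    rw [abs_mul, abs_mul, abs_mul, abs_of_pos hpi, abs_two]; ring
  rw [h1, h2]
  have h3 : 0 ≤ Real.pi * |t| := by positivity
  refine Real.cos_le_cos_of_nonneg_of_le_pi (by positivity) ?_ ?_
  · nlinarith
  · nlinarith

/-- At the endpoint `t = 1/2` coercivity degenerates to strict positivity. -/
theorem eq_zero_of_re_inner_mulExp_half {f : L2I}
    (h : (inner ℂ f (mulExp (1 / 2) f)).re = 0) : f = 0 := by
  rw [re_inner_mulExp] at h
  have hcos : ∀ x ∈ Set.Ioo (-1 / 2 : ℝ) (1 / 2), 0 < Real.cos (2 * Real.pi * (1 / 2) * x) := by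
    intro x hx
    have hpi := Real.pi_pos
    exact Real.cos_pos_of_mem_Ioo ⟨by nlinarith [hx.1], by nlinarith [hx.2]⟩
  have hmem : ∀ᵐ x ∂μI, x ∈ Set.Ioo (-1 / 2 : ℝ) (1 / 2) := by
    rw [μI, ← restrict_Ioo_eq_restrict_Icc]
    exact ae_restrict_mem measurableSet_Ioo
  rw [integral_eq_zero_iff_of_nonneg_ae _ (integrable_cos_mul_norm_sq (1 / 2) f)] at h
  · refine Lp.ext ?_
    filter_upwards [h, hmem, Lp.coeFn_zero ℂ 2 μI] with x h1 hx h2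
    rw [h2]
    simp only [Pi.zero_apply, mul_eq_zero, (hcos x hx).ne', false_or] at h1 ⊢
    simpa using h1
  · filter_upwards [hmem] with x hx
    exact mul_nonneg (hcos x hx).le (by positivity)

/-- The exponential `e^{2πitx}` as an element of `L²[-1/2, 1/2]`. -/
def expVec (t : ℝ) : L2I := windowedExp (fun _ => 1) memLp_one t

theorem mulExp_expVec (s t : ℝ) : mulExp s (expVec t) = expVec (s + t) := by
  refine Lp.ext ?_
  filter_upwards [coeFn_mulExp s (expVec t), coeFn_windowedExp _ memLp_one t,
    coeFn_windowedExp _ memLp_one (s + t)] with x h1 h2 h3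
  simp only [expVec] at *
  rw [h1, h2, h3, expFun_add]
  ring

theorem inner_expVec (t : ℝ) (f : L2I) :
    inner ℂ (expVec t) f = ∫ x in (-1 / 2 : ℝ)..(1 / 2), expFun (-t) x * f x := by
  rw [intervalIntegral.integral_of_le (by norm_num), ← integral_Icc_eq_integral_Ioc, L2.inner_def]
  refine integral_congr_ae ?_
  filter_upwards [coeFn_windowedExp _ memLp_one t] with x h1
  rw [expVec, h1, RCLike.inner_apply, one_mul, conj_expFun, mul_comm]

theorem expSystem_of_nonneg (ξ : ℝ) {n : ℤ} (hn : 0 ≤ n) : expSystem ξ n = expVec n := by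
  rw [expSystem, system, if_pos hn, expVec]

theorem expSystem_of_neg (ξ : ℝ) {n : ℤ} (hn : n < 0) : expSystem ξ n = expVec (ξ + n) := by
  rw [expSystem, system, if_neg (not_le.2 hn), expVec]
  refine Lp.ext ?_
  filter_upwards [coeFn_windowedExp _ (memLp_expFun ξ) n,
    coeFn_windowedExp _ memLp_one (ξ + n)] with x h1 h2
  rw [h1, h2, one_mul, expFun_add]

/-! ### The Fourier basis -/

theorem inner_expVec_int (n : ℤ) (f : L2I) :
    inner ℂ (expVec n) f = fourierCoeffOn (by norm_num : (-1 / 2 : ℝ) < 1 / 2) f n := by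
  rw [fourierCoeffOn_eq_integral, inner_expVec]
  norm_num
  refine intervalIntegral.integral_congr fun x _ => ?_
  simp only [← conj_expFun]
  simp [expFun]

theorem hasSum_norm_inner_expVec_sq (f : L2I) :
    HasSum (fun n : ℤ => ‖inner ℂ (expVec n) f‖ ^ 2) (‖f‖ ^ 2) := by
  simp only [inner_expVec_int]
  have hf : MemLp f 2 (volume.restrict (Set.Ioc (-1 / 2 : ℝ) (1 / 2))) := by
    rw [restrict_Ioc_eq_restrict_Icc]
    exact Lp.memLp f
  convert hasSum_sq_fourierCoeffOn (by norm_num : (-1 / 2 : ℝ) < 1 / 2) hf using 1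
  rw [intervalIntegral.integral_of_le (by norm_num), ← integral_Icc_eq_integral_Ioc,
    norm_sq_eq_integral, show (1 / 2 - -1 / 2 : ℝ) = 1 by norm_num, inv_one, one_smul]

theorem norm_expVec (t : ℝ) : ‖expVec t‖ = 1 := by
  have h : ‖expVec t‖ ^ 2 = 1 := by
    rw [norm_sq_eq_integral]
    trans ∫ _, (1 : ℝ) ∂μI
    · refine integral_congr_ae ?_
      filter_upwards [coeFn_windowedExp _ memLp_one t] with x h1
      rw [expVec, h1, one_mul, norm_expFun, one_pow]
    · norm_num [Measure.real]
  exact (pow_eq_one_iff_of_nonneg (norm_nonneg _) two_ne_zero).1 h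

theorem orthonormal_expVec : Orthonormal ℂ (fun n : ℤ => expVec n) := by
  refine ⟨fun n => norm_expVec n, fun n m hnm => ?_⟩
  have h := hasSum_norm_inner_expVec_sq (expVec m)
  -- In Parseval for the vector of index `m`, the term of index `m` already exhausts the total `1`,
  -- so no room is left for index `n`.
  have h1 := sum_le_hasSum {n, m} (fun i _ => sq_nonneg _) h
  rw [Finset.sum_pair hnm, inner_self_eq_norm_sq_to_K, norm_expVec] at h1
  have h2 : ‖inner ℂ (expVec n) (expVec m)‖ ^ 2 ≤ 0 := by simpa using h1
  simpa using le_antisymm h2 (sq_nonneg _)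

/-- The Fourier basis of `L²[-1/2, 1/2]`. -/
def expBasis : HilbertBasis ℤ ℂ L2I :=
  HilbertBasis.mkOfOrthogonalEqBot orthonormal_expVec (by
    rw [Submodule.eq_bot_iff]
    intro f hf
    have h : ∀ n : ℤ, inner ℂ (expVec n) f = 0 := fun n =>
      (Submodule.mem_orthogonal _ _).1 hf _ (Submodule.subset_span ⟨n, rfl⟩)
    have h2 := hasSum_norm_inner_expVec_sq f
    simp only [h, norm_zero, ne_eq, OfNat.ofNat_ne_zero, not_false_eq_true, zero_pow] at h2
    simpa using h2.unique hasSum_zero)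

theorem expBasis_apply (n : ℤ) : expBasis n = expVec n := by
  simp [expBasis]

/-! ### Analysis and synthesis operators -/

/-- The closed subspace of functions without negative frequencies. -/
def nonnegSubspace : Submodule ℂ L2I :=
  (Submodule.span ℂ {v | ∃ n : ℤ, n < 0 ∧ v = expVec n})ᗮ

instance : CompleteSpace nonnegSubspace :=
  (Submodule.isClosed_orthogonal _).completeSpace_coe

/-- The orthogonal projection onto the functions without negative frequencies. -/
def nonnegProj : L2I →L[ℂ] L2I := nonnegSubspace.starProjection

theorem inner_nonnegProj_left (f g : L2I) :
    inner ℂ (nonnegProj f) g = inner ℂ f (nonnegProj g) :=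
  Submodule.inner_starProjection_left_eq_right _ f g

theorem norm_nonnegProj_le (f : L2I) : ‖nonnegProj f‖ ≤ ‖f‖ :=
  Submodule.norm_starProjection_apply_le _ f

theorem norm_sub_nonnegProj_le (f : L2I) : ‖f - nonnegProj f‖ ≤ ‖f‖ := by
  have h := Submodule.norm_starProjection_apply_le nonnegSubspaceᗮ f
  rwa [Submodule.starProjection_orthogonal_val] at h

theorem nonnegProj_nonnegProj (f : L2I) : nonnegProj (nonnegProj f) = nonnegProj f :=
  Submodule.starProjection_eq_self_iff.2 (Submodule.starProjection_apply_mem _ f)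

theorem nonnegProj_expVec_of_nonneg {n : ℤ} (hn : 0 ≤ n) : nonnegProj (expVec n) = expVec n := by
  refine Submodule.starProjection_eq_self_iff.2 ?_
  rw [nonnegSubspace, Submodule.mem_orthogonal]
  intro u hu
  induction hu using Submodule.span_induction with
  | mem v hv =>
    obtain ⟨m, hm, rfl⟩ := hv
    exact orthonormal_expVec.2 (by omega : m ≠ n)
  | zero => exact inner_zero_left _
  | add u v _ _ hu hv => rw [inner_add_left, hu, hv, add_zero]
  | smul c u _ hu => rw [inner_smul_left, hu, mul_zero]

theorem nonnegProj_expVec_of_neg {n : ℤ} (hn : n < 0) : nonnegProj (expVec n) = 0 := by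
  refine (Submodule.starProjection_apply_eq_zero_iff _).2 ?_
  exact Submodule.le_orthogonal_orthogonal _ (Submodule.subset_span ⟨n, hn, rfl⟩)

/-- The analysis operator of `expSystem ξ`, with coefficients taken in the Fourier basis. -/
def analysis (ξ : ℝ) : L2I →L[ℂ] L2I :=
  nonnegProj + (ContinuousLinearMap.id ℂ L2I - nonnegProj).comp
    (mulExp (-ξ)).toContinuousLinearMap

theorem analysis_apply (ξ : ℝ) (f : L2I) :
    analysis ξ f = nonnegProj f + (mulExp (-ξ) f - nonnegProj (mulExp (-ξ) f)) := rfl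

/-- The projection is self-adjoint, fixes the exponentials with `n ≥ 0` and kills the others, so
each index selects one summand of `analysis`. -/
theorem inner_expSystem (ξ : ℝ) (n : ℤ) (f : L2I) :
    inner ℂ (expSystem ξ n) f = inner ℂ (expVec n) (analysis ξ f) := by
  rw [analysis_apply, inner_add_right, inner_sub_right, ← inner_nonnegProj_left,
    ← inner_nonnegProj_left]
  rcases le_or_gt 0 n with hn | hn
  · rw [nonnegProj_expVec_of_nonneg hn, expSystem_of_nonneg ξ hn, sub_self, add_zero]
  · rw [nonnegProj_expVec_of_neg hn, expSystem_of_neg ξ hn, inner_zero_left, inner_zero_left,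
      zero_add, sub_zero, ← inner_mulExp_left, mulExp_expVec]

theorem hasSum_norm_inner_expSystem_sq (ξ : ℝ) (f : L2I) :
    HasSum (fun n : ℤ => ‖inner ℂ (expSystem ξ n) f‖ ^ 2) (‖analysis ξ f‖ ^ 2) := by
  simp only [inner_expSystem]
  exact hasSum_norm_inner_expVec_sq _

theorem isCompleteFamily_expSystem_iff (ξ : ℝ) :
    IsCompleteFamily (expSystem ξ) ↔ ∀ f, analysis ξ f = 0 → f = 0 := by
  refine forall_congr' fun f => imp_congr_left ⟨fun h => ?_, fun h n => ?_⟩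
  · have h2 := hasSum_norm_inner_expSystem_sq ξ f
    simp only [h, norm_zero, ne_eq, OfNat.ofNat_ne_zero, not_false_eq_true, zero_pow] at h2
    simpa using h2.unique hasSum_zero
  · rw [inner_expSystem, h, inner_zero_right]

theorem norm_analysis_le (ξ : ℝ) (f : L2I) : ‖analysis ξ f‖ ≤ 2 * ‖f‖ := by
  rw [analysis_apply]
  refine (norm_add_le _ _).trans ?_
  have := norm_sub_nonnegProj_le (mulExp (-ξ) f)
  rw [LinearIsometry.norm_map] at this
  linarith [norm_nonnegProj_le f]

theorem isFrame_expSystem_iff (ξ : ℝ) :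
    IsFrame (expSystem ξ) ↔ ∃ c > 0, ∀ f, c * ‖f‖ ≤ ‖analysis ξ f‖ := by
  constructor
  · rintro ⟨A, B, hA, -, h⟩
    refine ⟨√A, Real.sqrt_pos.2 hA, fun f => ?_⟩
    have h1 := (h f).2.1
    rw [(hasSum_norm_inner_expSystem_sq ξ f).tsum_eq] at h1
    refine le_of_sq_le_sq ?_ (norm_nonneg _)
    rwa [mul_pow, Real.sq_sqrt hA.le]
  · rintro ⟨c, hc, h⟩
    -- The upper bound `4` is the square of the bound in `norm_analysis_le`; the maximum only
    -- secures `A ≤ B`.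
    refine ⟨c ^ 2, max (c ^ 2) 4, by positivity, le_max_left _ _, fun f => ?_⟩
    rw [(hasSum_norm_inner_expSystem_sq ξ f).tsum_eq]
    refine ⟨(hasSum_norm_inner_expSystem_sq ξ f).summable, ?_, ?_⟩
    · rw [← mul_pow]
      exact pow_le_pow_left₀ (by positivity) (h f) 2
    · calc ‖analysis ξ f‖ ^ 2 ≤ (2 * ‖f‖) ^ 2 :=
            pow_le_pow_left₀ (norm_nonneg _) (norm_analysis_le ξ f) 2
        _ = 4 * ‖f‖ ^ 2 := by ring
        _ ≤ max (c ^ 2) 4 * ‖f‖ ^ 2 := by gcongr; exact le_max_right _ _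

/-- The synthesis operator of `expSystem ξ`; it maps the Fourier basis to `expSystem ξ`. -/
def synthesis (ξ : ℝ) : L2I →L[ℂ] L2I := (analysis ξ).adjoint

theorem synthesis_expVec (ξ : ℝ) (n : ℤ) : synthesis ξ (expVec n) = expSystem ξ n := by
  refine ext_inner_right ℂ fun f => ?_
  rw [synthesis, ContinuousLinearMap.adjoint_inner_left, inner_expSystem]

theorem synthesis_apply (ξ : ℝ) (f : L2I) :
    synthesis ξ f = nonnegProj f + mulExp ξ (f - nonnegProj f) := by
  refine ext_inner_right ℂ fun g => ?_
  rw [synthesis, ContinuousLinearMap.adjoint_inner_left, analysis_apply, inner_add_left,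
    inner_add_right, inner_sub_right, inner_mulExp_left, inner_sub_left, inner_nonnegProj_left,
    inner_nonnegProj_left]

/-! ### The range `|ξ| ≤ 1/2` -/

theorem inner_sub_nonnegProj_nonnegProj (f g : L2I) :
    inner ℂ (f - nonnegProj f) (nonnegProj g) = 0 := by
  rw [← inner_nonnegProj_left, map_sub, nonnegProj_nonnegProj, sub_self, inner_zero_left]

theorem norm_le_nonnegProj_add (f : L2I) : ‖f‖ ≤ ‖nonnegProj f‖ + ‖f - nonnegProj f‖ := by
  simpa using norm_add_le (nonnegProj f) (f - nonnegProj f)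

theorem cos_pi_mul_pos {ξ : ℝ} (h : |ξ| < 1 / 2) : 0 < Real.cos (Real.pi * ξ) := by
  have hpi := Real.pi_pos
  obtain ⟨h1, h2⟩ := abs_lt.1 h
  exact Real.cos_pos_of_mem_Ioo ⟨by nlinarith, by nlinarith⟩

/-- Pairing with the negative-frequency part `b` eliminates the orthogonal part `a`, so coercivity
controls `b`; then `a` is recovered by subtraction. -/
theorem synthesis_bounded_below {ξ : ℝ} (hξ : |ξ| < 1 / 2) :
    ∃ c > 0, ∀ f, c * ‖f‖ ≤ ‖synthesis ξ f‖ := by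
  have hc := cos_pi_mul_pos hξ
  set c := Real.cos (Real.pi * ξ) with hcdef
  refine ⟨(1 + 2 / c)⁻¹, by positivity, fun f => ?_⟩
  set a := nonnegProj f with ha
  set b := f - nonnegProj f with hb
  have h1 : inner ℂ b (synthesis ξ f) = inner ℂ b (mulExp ξ b) := by
    rw [synthesis_apply, inner_add_right, inner_sub_nonnegProj_nonnegProj, zero_add]
  have h2 : c * ‖b‖ ^ 2 ≤ ‖b‖ * ‖synthesis ξ f‖ := by
    refine (cos_mul_norm_sq_le_re_inner hξ.le b).trans ?_
    rw [← h1]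
    exact (Complex.re_le_norm _).trans (norm_inner_le_norm _ _)
  have h3 : c * ‖b‖ ≤ ‖synthesis ξ f‖ := by
    rcases (norm_nonneg b).eq_or_lt with h | h
    · rw [← h, mul_zero]; exact norm_nonneg _
    · nlinarith
  have h4 : ‖a‖ ≤ ‖synthesis ξ f‖ + ‖b‖ := by
    have : a = synthesis ξ f - mulExp ξ b := by rw [synthesis_apply, add_sub_cancel_right]
    rw [this]
    exact (norm_sub_le _ _).trans_eq (by rw [LinearIsometry.norm_map])
  have h5 : ‖b‖ ≤ ‖synthesis ξ f‖ / c := by rw [le_div_iff₀ hc]; linarith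
  rw [inv_mul_le_iff₀ (by positivity)]
  calc ‖f‖ ≤ ‖a‖ + ‖b‖ := norm_le_nonnegProj_add f
    _ ≤ ‖synthesis ξ f‖ + 2 * (‖synthesis ξ f‖ / c) := by linarith
    _ = (1 + 2 / c) * ‖synthesis ξ f‖ := by ring

theorem nonnegProj_analysis (ξ : ℝ) (f : L2I) :
    nonnegProj (analysis ξ f) = nonnegProj f := by
  rw [analysis_apply, map_add, map_sub, nonnegProj_nonnegProj, nonnegProj_nonnegProj, sub_self,
    add_zero]

theorem inner_sub_nonnegProj_analysis (ξ : ℝ) (f : L2I) :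
    inner ℂ (f - nonnegProj f) (analysis ξ f)
      = inner ℂ (f - nonnegProj f) (mulExp (-ξ) (nonnegProj f))
        + inner ℂ (f - nonnegProj f) (mulExp (-ξ) (f - nonnegProj f)) := by
  rw [analysis_apply, inner_add_right, inner_sub_nonnegProj_nonnegProj, zero_add, inner_sub_right,
    inner_sub_nonnegProj_nonnegProj, sub_zero, ← inner_add_right, ← map_add, add_sub_cancel]

/-- The operator is triangular: its nonnegative-frequency part is `a` itself, and coercivity
controls `b` up to a cross term of size `‖a‖ ‖b‖`. -/
theorem analysis_bounded_below {ξ : ℝ} (hξ : |ξ| < 1 / 2) :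
    ∃ c > 0, ∀ f, c * ‖f‖ ≤ ‖analysis ξ f‖ := by
  rw [← abs_neg] at hξ
  have hc := cos_pi_mul_pos hξ
  set c := Real.cos (Real.pi * -ξ) with hcdef
  refine ⟨(1 + 2 / c)⁻¹, by positivity, fun f => ?_⟩
  set a := nonnegProj f with ha
  set b := f - nonnegProj f with hb
  have h1 : ‖a‖ ≤ ‖analysis ξ f‖ := by
    rw [ha, ← nonnegProj_analysis ξ]
    exact norm_nonnegProj_le _
  have h2 : c * ‖b‖ ^ 2 ≤ ‖b‖ * ‖analysis ξ f‖ + ‖b‖ * ‖a‖ := by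
    refine (cos_mul_norm_sq_le_re_inner hξ.le b).trans ?_
    rw [← sub_eq_of_eq_add' (inner_sub_nonnegProj_analysis ξ f)]
    refine (Complex.re_le_norm _).trans ((norm_sub_le _ _).trans (add_le_add ?_ ?_))
    · exact norm_inner_le_norm _ _
    · refine (norm_inner_le_norm _ _).trans_eq ?_
      rw [LinearIsometry.norm_map]
  have h3 : c * ‖b‖ ≤ ‖analysis ξ f‖ + ‖a‖ := by
    rcases (norm_nonneg b).eq_or_lt with h | h
    · rw [← h, mul_zero]; positivity
    · nlinarith
  have h5 : ‖b‖ ≤ 2 * ‖analysis ξ f‖ / c := by rw [le_div_iff₀ hc]; linarith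
  rw [inv_mul_le_iff₀ (by positivity)]
  calc ‖f‖ ≤ ‖a‖ + ‖b‖ := norm_le_nonnegProj_add f
    _ ≤ ‖analysis ξ f‖ + 2 * ‖analysis ξ f‖ / c := by linarith
    _ = (1 + 2 / c) * ‖analysis ξ f‖ := by ring

/-- An operator on a Hilbert space that is bounded below together with its adjoint is bijective. -/
theorem bijective_of_bounded_below {H : Type*} [NormedAddCommGroup H] [InnerProductSpace ℂ H]
    [CompleteSpace H] (T : H →L[ℂ] H) {c : ℝ} (hc : 0 < c) (h : ∀ f, c * ‖f‖ ≤ ‖T f‖)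
    (h' : ∀ f, T.adjoint f = 0 → f = 0) : Function.Bijective T := by
  have hanti : AntilipschitzWith (Real.toNNReal c⁻¹) T := by
    refine ContinuousLinearMap.antilipschitz_of_bound T fun f => ?_
    rw [Real.coe_toNNReal _ (by positivity), ← div_eq_inv_mul, le_div_iff₀ hc]
    linarith [h f]
  refine ⟨hanti.injective, ?_⟩
  have hclosed : IsClosed (T.range : Set H) := by
    rw [LinearMap.coe_range]
    exact hanti.isClosed_range T.uniformContinuous
  have horth : T.rangeᗮ = ⊥ := by
    rw [ContinuousLinearMap.orthogonal_range, LinearMap.ker_eq_bot']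
    exact h'
  rw [← Submodule.topologicalClosure_eq_top_iff, hclosed.submodule_topologicalClosure_eq] at horth
  exact LinearMap.range_eq_top.1 horth

/-- Synthesis is invertible, so existence and uniqueness of expansions transfer from the orthonormal
Fourier basis. -/
theorem isRieszBasis_expSystem {ξ : ℝ} (hξ : |ξ| < 1 / 2) : IsRieszBasis (expSystem ξ) := by
  obtain ⟨c, hc, hca⟩ := analysis_bounded_below hξ
  refine ⟨(isFrame_expSystem_iff ξ).2 ⟨c, hc, hca⟩, fun f => ?_⟩
  obtain ⟨d, hd, hds⟩ := synthesis_bounded_below hξ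
  have hbij : Function.Bijective (synthesis ξ) := by
    refine bijective_of_bounded_below _ hd hds fun f hf => ?_
    rw [synthesis, ContinuousLinearMap.adjoint_adjoint] at hf
    have := hca f
    rw [hf, norm_zero] at this
    exact norm_le_zero_iff.1 (by nlinarith [norm_nonneg f])
  let E : L2I ≃L[ℂ] L2I := ContinuousLinearEquiv.ofBijective (synthesis ξ)
    (LinearMap.ker_eq_bot.2 hbij.1) (LinearMap.range_eq_top.2 hbij.2)
  have hE : ∀ g, E g = synthesis ξ g := fun g => rfl
  refine ⟨fun n => expBasis.repr (E.symm f) n, ?_, fun α hα => ?_⟩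
  · have h := (expBasis.hasSum_repr (E.symm f)).mapL (synthesis ξ)
    simp only [map_smul, expBasis_apply, synthesis_expVec] at h
    rwa [← hE, E.apply_symm_apply] at h
  · have h := hα.mapL (E.symm : L2I →L[ℂ] L2I)
    have h2 : ∀ n, E.symm (expSystem ξ n) = expVec n := fun n => by
      rw [E.symm_apply_eq, hE, synthesis_expVec]
    simp only [ContinuousLinearEquiv.coe_coe, map_smul, h2] at h
    funext m
    rw [HilbertBasis.repr_apply_apply, expBasis_apply]
    have h3 := h.mapL (innerSL ℂ (expVec m))
    simp only [innerSL_apply_apply, inner_smul_right] at h3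
    refine (hasSum_single m fun n hn => ?_).unique h3 |>.symm ▸ ?_
    · rw [orthonormal_expVec.2 hn.symm, mul_zero]
    · rw [inner_self_eq_norm_sq_to_K, norm_expVec]; simp

/-- A vector in the kernel of `analysis` has no nonnegative frequencies, and is then orthogonal to
its own modulation by `1/2`. -/
theorem isCompleteFamily_expSystem_neg_half : IsCompleteFamily (expSystem (-1 / 2)) := by
  rw [isCompleteFamily_expSystem_iff]
  intro f hf
  have h1 : nonnegProj f = 0 := by rw [← nonnegProj_analysis (-1 / 2), hf, map_zero]
  have h2 := inner_sub_nonnegProj_analysis (-1 / 2) f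
  rw [hf, h1, sub_zero, map_zero, inner_zero_right, zero_add,
    show (-(-1 / 2) : ℝ) = 1 / 2 by norm_num] at h2
  exact eq_zero_of_re_inner_mulExp_half (by rw [← h2, Complex.zero_re])

/-! ### Passing from `ξ` to `ξ + 1` -/

/-- The injection `ℤ → ℤ` with range `ℤ ∖ {0}` that moves the nonnegative integers up by one. -/
def skipZero (m : ℤ) : ℤ := if 0 ≤ m then m + 1 else m

theorem skipZero_injective : Function.Injective skipZero := by
  intro m n h
  simp only [skipZero] at h
  split_ifs at h <;> omega

theorem skipZero_ne_zero (m : ℤ) : skipZero m ≠ 0 := by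
  simp only [skipZero]
  split_ifs <;> omega

theorem eq_zero_of_notMem_range_skipZero {k : ℤ} (hk : k ∉ Set.range skipZero) : k = 0 := by
  by_contra h
  rcases lt_or_gt_of_ne h with h | h
  · exact hk ⟨k, by simp [skipZero, not_le.2 h]⟩
  · refine hk ⟨k - 1, ?_⟩
    rw [skipZero, if_pos (by omega)]
    omega

/-- Up to a modulation, `expSystem ξ` is `expSystem (ξ + 1)` with the index `0` removed. -/
theorem expSystem_add_one_skipZero (ξ : ℝ) (m : ℤ) :
    expSystem (ξ + 1) (skipZero m) = mulExp 1 (expSystem ξ m) := by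
  rcases le_or_gt 0 m with hm | hm
  · rw [skipZero, if_pos hm, expSystem_of_nonneg _ hm, expSystem_of_nonneg _ (by omega),
      mulExp_expVec]
    push_cast
    rw [add_comm]
  · rw [skipZero, if_neg (not_le.2 hm), expSystem_of_neg _ hm, expSystem_of_neg _ hm,
      mulExp_expVec]
    ring_nf

/-- The frame sum splits into the added index `0`, whose vector demodulates to frequency `-1`, and
the frame sum for `ξ`. -/
theorem norm_analysis_add_one_sq (ξ : ℝ) (f : L2I) :
    ‖analysis (ξ + 1) (mulExp 1 f)‖ ^ 2
      = ‖inner ℂ (expVec (-1)) f‖ ^ 2 + ‖analysis ξ f‖ ^ 2 := by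
  have h0 : inner ℂ (expSystem (ξ + 1) 0) (mulExp 1 f) = inner ℂ (expVec (-1)) f := by
    rw [expSystem_of_nonneg _ le_rfl, ← neg_neg (1 : ℝ), ← inner_mulExp_left, mulExp_expVec]
    simp
  set g : ℤ → ℝ := fun k => ‖inner ℂ (expSystem (ξ + 1) k) (mulExp 1 f)‖ ^ 2 with hg
  have h1 : HasSum (fun k => if k = 0 then 0 else g k) (‖analysis ξ f‖ ^ 2) := by
    refine (skipZero_injective.hasSum_iff fun k hk => ?_).1 ?_
    · rw [if_pos (eq_zero_of_notMem_range_skipZero hk)]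
    · convert hasSum_norm_inner_expSystem_sq ξ f using 2 with m
      rw [Function.comp_apply, if_neg (skipZero_ne_zero m), hg]
      simp only [expSystem_add_one_skipZero, LinearIsometry.inner_map_map]
  have h2 := (hasSum_ite_eq (0 : ℤ) (g 0)).add h1
  rw [← h0]
  refine (hasSum_norm_inner_expSystem_sq (ξ + 1) (mulExp 1 f)).unique ?_
  convert h2 using 2 with k
  by_cases hk : k = 0
  · simp [hk, hg]
  · simp [hk, hg]

theorem norm_analysis_le_add_one (ξ : ℝ) (f : L2I) :
    ‖analysis ξ (mulExp (-1) f)‖ ≤ ‖analysis (ξ + 1) f‖ := by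
  have h := norm_analysis_add_one_sq ξ (mulExp (-1) f)
  rw [mulExp_mulExp_neg] at h
  refine le_of_sq_le_sq ?_ (norm_nonneg _)
  rw [h]
  exact le_add_of_nonneg_left (sq_nonneg _)

theorem isCompleteFamily_expSystem_add_one {ξ : ℝ} (h : IsCompleteFamily (expSystem ξ)) :
    IsCompleteFamily (expSystem (ξ + 1)) := by
  rw [isCompleteFamily_expSystem_iff] at h ⊢
  intro f hf
  have h1 := norm_analysis_le_add_one ξ f
  rw [hf, norm_zero, norm_le_zero_iff] at h1
  rw [← mulExp_mulExp_neg 1 f, h _ h1, map_zero]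

theorem isFrame_expSystem_add_one {ξ : ℝ} (h : IsFrame (expSystem ξ)) :
    IsFrame (expSystem (ξ + 1)) := by
  rw [isFrame_expSystem_iff] at h ⊢
  obtain ⟨c, hc, h⟩ := h
  refine ⟨c, hc, fun f => ?_⟩
  have h1 := (h (mulExp (-1) f)).trans (norm_analysis_le_add_one ξ f)
  rwa [LinearIsometry.norm_map] at h1

/-- If an injective operator becomes bounded below after adding one linear functional, then it is
itself bounded below. -/
theorem bounded_below_of_bounded_below_add_inner {H : Type*} [NormedAddCommGroup H]
    [InnerProductSpace ℂ H] [CompleteSpace H] (L : H →L[ℂ] H) (v : H) {c : ℝ} (hc : 0 < c)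
    (h : ∀ f, c * ‖f‖ ≤ ‖inner ℂ v f‖ + ‖L f‖) (hL : ∀ f, L f = 0 → f = 0) :
    ∃ c > 0, ∀ f, c * ‖f‖ ≤ ‖L f‖ := by
  let G : H →L[ℂ] ℂ × H := (innerSL ℂ v).prod L
  have hG : ∀ f, G f = (inner ℂ v f, L f) := fun f => rfl
  have hanti : AntilipschitzWith (Real.toNNReal (2 / c)) G := by
    refine ContinuousLinearMap.antilipschitz_of_bound G fun f => ?_
    rw [Real.coe_toNNReal _ (by positivity), div_mul_eq_mul_div, le_div_iff₀ hc]
    have h1 : ‖inner ℂ v f‖ ≤ ‖G f‖ := norm_fst_le (G f)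
    have h2 : ‖L f‖ ≤ ‖G f‖ := norm_snd_le (G f)
    linarith [h f]
  have hclosed : IsClosed (Set.range G) := hanti.isClosed_range G.uniformContinuous
  -- Injectivity of `L` keeps `(1, 0)` out of the closed range of `G`, hence at a positive distance
  -- `ε` from it.
  have hmem : ((1 : ℂ), (0 : H)) ∈ (Set.range G)ᶜ := by
    rintro ⟨f, hf⟩
    rw [hG, Prod.mk.injEq] at hf
    rw [hL f hf.2, inner_zero_right] at hf
    exact zero_ne_one hf.1
  obtain ⟨ε, hε, hball⟩ := Metric.isOpen_iff.1 hclosed.isOpen_compl _ hmem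
  have key : ∀ f, ε * ‖inner ℂ v f‖ ≤ ‖L f‖ := by
    intro f
    by_cases hv : inner ℂ v f = 0
    · rw [hv, norm_zero, mul_zero]; exact norm_nonneg _
    by_contra! hlt
    -- Rescaled to have first coordinate `1`, the vector has its image under `G` within `ε` of `(1,
    -- 0)`, a contradiction.
    refine hball ?_ ⟨(inner ℂ v f)⁻¹ • f, rfl⟩
    rw [hG, inner_smul_right, inv_mul_cancel₀ hv, mem_ball_iff_norm, Prod.mk_sub_mk, sub_self,
      sub_zero, map_smul, Prod.norm_mk, norm_zero, norm_smul, norm_inv]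
    refine max_lt hε ?_
    rw [inv_mul_lt_iff₀ (norm_pos_iff.2 hv)]
    linarith
  refine ⟨c / (1 / ε + 1), by positivity, fun f => ?_⟩
  rw [div_mul_eq_mul_div, div_le_iff₀ (by positivity)]
  have h1 : ‖inner ℂ v f‖ ≤ ‖L f‖ / ε := by rw [le_div_iff₀ hε]; linarith [key f]
  calc c * ‖f‖ ≤ ‖inner ℂ v f‖ + ‖L f‖ := h f
    _ ≤ ‖L f‖ / ε + ‖L f‖ := by linarith
    _ = ‖L f‖ * (1 / ε + 1) := by ring

theorem isFrame_expSystem_of_add_one {ξ : ℝ} (h : IsFrame (expSystem (ξ + 1)))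
    (hc : IsCompleteFamily (expSystem ξ)) : IsFrame (expSystem ξ) := by
  rw [isFrame_expSystem_iff] at h ⊢
  rw [isCompleteFamily_expSystem_iff] at hc
  obtain ⟨c, hc0, h⟩ := h
  refine bounded_below_of_bounded_below_add_inner (analysis ξ) (expVec (-1)) hc0 (fun f => ?_) hc
  have h1 := h (mulExp 1 f)
  rw [LinearIsometry.norm_map] at h1
  refine h1.trans (le_of_sq_le_sq ?_ (by positivity))
  rw [norm_analysis_add_one_sq]
  nlinarith [norm_nonneg (inner ℂ (expVec (-1)) f), norm_nonneg (analysis ξ f)]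

theorem exists_hasSum_expSystem_add_one {ξ : ℝ}
    (h : ∀ f : L2I, ∃ α : ℤ → ℂ, HasSum (fun i => α i • expSystem ξ i) f) (f : L2I) :
    ∃ α : ℤ → ℂ, α 0 = 0 ∧ HasSum (fun i => α i • expSystem (ξ + 1) i) f := by
  obtain ⟨β, hβ⟩ := h (mulExp (-1) f)
  have hout : ∀ k ∉ Set.range skipZero, Function.extend skipZero β 0 k = 0 := fun k hk =>
    Function.extend_apply' _ _ _ hk
  refine ⟨Function.extend skipZero β 0, hout 0 fun ⟨m, hm⟩ => skipZero_ne_zero m hm, ?_⟩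
  refine (skipZero_injective.hasSum_iff fun k hk => ?_).1 ?_
  · rw [hout k hk, zero_smul]
  · have h1 := hβ.mapL (mulExp 1).toContinuousLinearMap
    simp only [LinearIsometry.coe_toContinuousLinearMap, map_smul, mulExp_mulExp_neg] at h1
    convert h1 using 2 with m
    rw [Function.comp_apply, skipZero_injective.extend_apply, expSystem_add_one_skipZero]

/-- The vector of index `0` is redundant: it has its trivial expansion and another one whose
coefficient at `0` vanishes. -/
theorem not_isRieszBasis_expSystem_add_one {ξ : ℝ}
    (h : ∀ f : L2I, ∃ α : ℤ → ℂ, HasSum (fun i => α i • expSystem ξ i) f) :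
    ¬ IsRieszBasis (expSystem (ξ + 1)) := by
  intro hR
  obtain ⟨α, hα0, hα⟩ := exists_hasSum_expSystem_add_one h (expSystem (ξ + 1) 0)
  have h1 : HasSum (fun i => (Pi.single 0 1 : ℤ → ℂ) i • expSystem (ξ + 1) i)
      (expSystem (ξ + 1) 0) := by
    convert hasSum_single (0 : ℤ) fun i hi => ?_ using 1
    · rw [Pi.single_eq_same, one_smul]
    · rw [Pi.single_eq_of_ne hi, zero_smul]
  have h2 := congrFun ((hR.2 _).unique hα h1) 0
  rw [hα0, Pi.single_eq_same] at h2
  exact zero_ne_one h2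

/-! ### Integer translates and stability of frames -/

theorem isFrame_and_exists_hasSum_expSystem (n : ℕ) {ξ : ℝ} (hξ : |ξ| < 1 / 2) :
    IsFrame (expSystem (ξ + n)) ∧
      ∀ f : L2I, ∃ α : ℤ → ℂ, HasSum (fun i => α i • expSystem (ξ + n) i) f := by
  induction n with
  | zero =>
    rw [Nat.cast_zero, add_zero]
    exact ⟨(isRieszBasis_expSystem hξ).1, fun f => ((isRieszBasis_expSystem hξ).2 f).exists⟩
  | succ n ih =>
    rw [Nat.cast_succ, ← add_assoc]
    refine ⟨isFrame_expSystem_add_one ih.1, fun f => ?_⟩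
    obtain ⟨α, -, hα⟩ := exists_hasSum_expSystem_add_one ih.2 f
    exact ⟨α, hα⟩

theorem isCompleteFamily_expSystem_neg_half_add (n : ℕ) :
    IsCompleteFamily (expSystem (-1 / 2 + n)) := by
  induction n with
  | zero => simpa using isCompleteFamily_expSystem_neg_half
  | succ n ih =>
    rw [Nat.cast_succ, ← add_assoc]
    exact isCompleteFamily_expSystem_add_one ih

/-- The frame property is stable under small changes of `ξ`. -/
theorem isFrame_expSystem_of_near {ξ : ℝ} (h : IsFrame (expSystem ξ)) :
    ∃ δ > 0, ∀ η, |η - ξ| ≤ δ → IsFrame (expSystem η) := by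
  obtain ⟨c, hc, h⟩ := (isFrame_expSystem_iff ξ).1 h
  have hpi := Real.pi_pos
  -- Chosen so that the perturbation of `analysis`, of norm at most `π|η - ξ|`, uses up at most half
  -- of the lower bound `c`.
  refine ⟨c / (2 * Real.pi), by positivity, fun η hη => ?_⟩
  refine (isFrame_expSystem_iff η).2 ⟨c / 2, by positivity, fun f => ?_⟩
  have h1 : ‖analysis ξ f - analysis η f‖ ≤ c / 2 * ‖f‖ := by
    have h2 : analysis ξ f - analysis η f = (mulExp (-ξ) f - mulExp (-η) f)
        - nonnegProj (mulExp (-ξ) f - mulExp (-η) f) := by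
      rw [analysis_apply, analysis_apply, map_sub]
      abel
    rw [h2]
    refine (norm_sub_nonnegProj_le _).trans ((norm_mulExp_sub_le _ _ f).trans ?_)
    refine mul_le_mul_of_nonneg_right ?_ (norm_nonneg _)
    rw [show -ξ - -η = η - ξ by ring]
    calc Real.pi * |η - ξ| ≤ Real.pi * (c / (2 * Real.pi)) := by gcongr
      _ = c / 2 := by field_simp
  have h3 := norm_sub_norm_le (analysis ξ f) (analysis η f)
  linarith [h f]

theorem IsFrame.isCompleteFamily {ι H : Type*} [NormedAddCommGroup H] [InnerProductSpace ℂ H]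
    {φ : ι → H} (h : IsFrame φ) : IsCompleteFamily φ := by
  obtain ⟨A, B, hA, -, h⟩ := h
  intro f hf
  have h1 := (h f).2.1
  simp only [hf, norm_zero, ne_eq, OfNat.ofNat_ne_zero, not_false_eq_true, zero_pow,
    tsum_zero] at h1
  by_contra hne
  have := norm_pos_iff.2 hne
  have : 0 < A * ‖f‖ ^ 2 := by positivity
  linarith

/-! ### Incompleteness for `ξ < -1/2` -/

theorem cos_pi_mul_pos_of_mem {x : ℝ} (hx : x ∈ Set.Ioo (-1 / 2 : ℝ) (1 / 2)) :
    0 < Real.cos (Real.pi * x) :=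
  cos_pi_mul_pos (abs_lt.2 ⟨by linarith [hx.1], hx.2⟩)

/-- For negative `p`, the bound `cos πx ≥ 1/2 - |x|` dominates the integrand by powers of the
distances to the endpoints. -/
theorem intervalIntegrable_cos_rpow {p : ℝ} (hp : -1 < p) :
    IntervalIntegrable (fun x => Real.cos (Real.pi * x) ^ p) volume (-1 / 2) (1 / 2) := by
  have hcos : Continuous fun x : ℝ => Real.cos (Real.pi * x) := by fun_prop
  rcases le_or_gt 0 p with h0 | h0
  · exact (hcos.rpow_const fun x => Or.inr h0).intervalIntegrable _ _
  have h1 : IntervalIntegrable (fun x : ℝ => (1 / 2 - x) ^ p) volume (-1 / 2) (1 / 2) := by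
    convert (intervalIntegral.intervalIntegrable_rpow' (a := 1) (b := 0) hp).comp_sub_left (1 / 2)
      using 1 <;> norm_num
  have h2 : IntervalIntegrable (fun x : ℝ => (1 / 2 + x) ^ p) volume (-1 / 2) (1 / 2) := by
    convert (intervalIntegral.intervalIntegrable_rpow' (a := 0) (b := 1) hp).comp_add_left (1 / 2)
      using 1 <;> norm_num
  refine (h1.add h2).mono_fun' (hcos.measurable.pow_const p).aestronglyMeasurable ?_
  rw [Set.uIoc_of_le (by norm_num), restrict_Ioc_eq_restrict_Icc, ← restrict_Ioo_eq_restrict_Icc]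
  filter_upwards [ae_restrict_mem measurableSet_Ioo] with x hx
  have hpi := Real.pi_pos
  have habs : |x| < 1 / 2 := abs_lt.2 ⟨by linarith [hx.1], hx.2⟩
  have hle : 1 / 2 - |x| ≤ Real.cos (Real.pi * x) := by
    rw [← Real.cos_abs, abs_mul, abs_of_pos hpi]
    have h3 := Real.one_sub_mul_le_cos (x := Real.pi * |x|) (by positivity) (by nlinarith)
    have h4 : 2 / Real.pi * (Real.pi * |x|) = 2 * |x| := by field_simp
    rw [h4] at h3
    linarith
  have hpos : 0 < 1 / 2 - |x| := by linarith
  rw [Real.norm_of_nonneg (Real.rpow_nonneg (hpos.le.trans hle) p)]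
  refine (Real.rpow_le_rpow_of_nonpos hpos hle h0.le).trans ?_
  have ha : 0 ≤ (1 / 2 - x) ^ p := Real.rpow_nonneg (by linarith [hx.2]) p
  have hb : 0 ≤ (1 / 2 + x) ^ p := Real.rpow_nonneg (by linarith [hx.1]) p
  rcases abs_cases x with ⟨h, -⟩ | ⟨h, -⟩
  · rw [h]; exact le_add_of_nonneg_right hb
  · rw [h, sub_neg_eq_add]; exact le_add_of_nonneg_left ha

/-- `(cos πx)^p e^{2πitx}`. -/
def cosPowExp (p t x : ℝ) : ℂ := ((Real.cos (Real.pi * x) ^ p : ℝ) : ℂ) * expFun t x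

theorem intervalIntegrable_cosPowExp {p : ℝ} (hp : -1 < p) (t : ℝ) :
    IntervalIntegrable (cosPowExp p t) volume (-1 / 2) (1 / 2) := by
  have h := (intervalIntegrable_iff.1 (intervalIntegrable_cos_rpow hp)).ofReal (𝕜 := ℂ)
  exact (intervalIntegrable_iff.2 h).mul_continuousOn (continuous_expFun t).continuousOn

theorem hasDerivAt_expFun (t x : ℝ) :
    HasDerivAt (expFun t) (2 * Real.pi * Complex.I * t * expFun t x) x := by
  have h : HasDerivAt (fun y : ℝ => (2 * Real.pi * Complex.I * t * y : ℂ))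
      (2 * Real.pi * Complex.I * t) x := by
    simpa using (Complex.ofRealCLM.hasDerivAt (x := x)).const_mul (2 * Real.pi * Complex.I * t : ℂ)
  exact h.cexp.congr_deriv (mul_comm _ _)

/-- Writing sine and cosine through `e^{±πix}` turns the derivative into a combination of functions
of the same type, with exponent lowered by one and frequencies `t ± 1/2`. -/
theorem hasDerivAt_cosPowExp (p t : ℝ) {x : ℝ} (hx : x ∈ Set.Ioo (-1 / 2 : ℝ) (1 / 2)) :
    HasDerivAt (cosPowExp (p + 1) t)
      (Real.pi * Complex.I * (((p + 1) / 2 + t) * cosPowExp p (t + 1 / 2) x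
        + (t - (p + 1) / 2) * cosPowExp p (t - 1 / 2) x)) x := by
  have hc := cos_pi_mul_pos_of_mem hx
  have h1 : HasDerivAt (fun y : ℝ => Real.cos (Real.pi * y) ^ (p + 1))
      (-Real.sin (Real.pi * x) * Real.pi * (p + 1) * Real.cos (Real.pi * x) ^ p) x := by
    have h := ((hasDerivAt_id x).const_mul Real.pi).cos.rpow_const (p := p + 1) (Or.inl hc.ne')
    simpa using h
  have h2 := h1.ofReal_comp.mul (hasDerivAt_expFun t x)
  refine h2.congr_deriv ?_
  have hE : expFun (1 / 2) x = Real.cos (Real.pi * x) + Real.sin (Real.pi * x) * Complex.I := by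
    rw [expFun, Complex.ofReal_cos, Complex.ofReal_sin, ← Complex.exp_mul_I]
    push_cast
    ring_nf
  have hE' : expFun (-(1 / 2)) x
      = Real.cos (Real.pi * x) - Real.sin (Real.pi * x) * Complex.I := by
    rw [← conj_expFun, hE]
    simp only [map_add, map_mul, Complex.conj_ofReal, Complex.conj_I]
    ring
  rw [cosPowExp, cosPowExp, sub_eq_add_neg t, expFun_add, expFun_add, hE, hE',
    Real.rpow_add_one hc.ne']
  simp only [Complex.ofReal_mul, Complex.ofReal_neg, Complex.ofReal_add, Complex.ofReal_one]
  linear_combination (-(Real.pi : ℂ) * (p + 1) * Real.sin (Real.pi * x)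
    * (Real.cos (Real.pi * x) ^ p : ℝ) * expFun t x) * Complex.I_mul_I

/-- Integrate the derivative: the boundary values vanish because `p + 1 > 0`. -/
theorem integral_cosPowExp_recurrence {p : ℝ} (hp : -1 < p) (t : ℝ) :
    ((p + 1) / 2 + t) * (∫ x in (-1 / 2 : ℝ)..(1 / 2), cosPowExp p (t + 1 / 2) x)
      + (t - (p + 1) / 2) * (∫ x in (-1 / 2 : ℝ)..(1 / 2), cosPowExp p (t - 1 / 2) x) = 0 := by
  have hi1 := (intervalIntegrable_cosPowExp hp (t + 1 / 2)).const_mul ((p + 1) / 2 + t : ℂ)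
  have hi2 := (intervalIntegrable_cosPowExp hp (t - 1 / 2)).const_mul (t - (p + 1) / 2 : ℂ)
  have hcont : Continuous (cosPowExp (p + 1) t) := by
    unfold cosPowExp
    refine (Complex.continuous_ofReal.comp ?_).mul (continuous_expFun t)
    exact (by fun_prop : Continuous fun x : ℝ => Real.cos (Real.pi * x)).rpow_const
      fun x => Or.inr (by linarith)
  have h := intervalIntegral.integral_eq_sub_of_hasDerivAt_of_le (by norm_num) hcont.continuousOn
    (fun x hx => hasDerivAt_cosPowExp p t hx) ((hi1.add hi2).const_mul _)
  have h1 : cosPowExp (p + 1) t (1 / 2) = 0 := by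
    rw [cosPowExp, mul_one_div, Real.cos_pi_div_two, Real.zero_rpow (by linarith)]; simp
  have h2 : cosPowExp (p + 1) t (-1 / 2) = 0 := by
    rw [cosPowExp, show Real.pi * (-1 / 2) = -(Real.pi / 2) by ring, Real.cos_neg,
      Real.cos_pi_div_two, Real.zero_rpow (by linarith)]; simp
  rw [h1, h2, sub_zero, intervalIntegral.integral_const_mul, intervalIntegral.integral_add hi1 hi2,
    intervalIntegral.integral_const_mul, intervalIntegral.integral_const_mul] at h
  exact (mul_eq_zero.1 h).resolve_left
    (mul_ne_zero (Complex.ofReal_ne_zero.2 Real.pi_ne_zero) Complex.I_ne_zero)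

theorem integral_cosPowExp_eq_zero {p : ℝ} (hp : -1 < p) (m : ℕ) :
    ∫ x in (-1 / 2 : ℝ)..(1 / 2), cosPowExp p (p / 2 + (m + 1)) x = 0 := by
  have hrec : ∀ m : ℕ, ((p + 1 + m : ℝ) : ℂ)
      * (∫ x in (-1 / 2 : ℝ)..(1 / 2), cosPowExp p (p / 2 + (m + 1)) x)
      + m * (∫ x in (-1 / 2 : ℝ)..(1 / 2), cosPowExp p (p / 2 + m) x) = 0 := by
    intro m
    -- At this frequency the coefficients are `p + 1 + m`, never zero, and `m`, which vanishes at
    -- the start and so launches the induction.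
    have h := integral_cosPowExp_recurrence hp (p / 2 + 1 / 2 + m)
    rw [show p / 2 + 1 / 2 + m + 1 / 2 = p / 2 + ((m : ℝ) + 1) by ring,
      show p / 2 + 1 / 2 + m - 1 / 2 = p / 2 + (m : ℝ) by ring] at h
    rw [← h]
    push_cast
    ring
  have hne : ∀ m : ℕ, ((p + 1 + m : ℝ) : ℂ) ≠ 0 := fun m => by
    rw [Complex.ofReal_ne_zero]
    have : (0 : ℝ) ≤ m := m.cast_nonneg
    linarith
  induction m with
  | zero =>
    have h := hrec 0
    rw [Nat.cast_zero (R := ℂ), zero_mul, add_zero] at h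
    exact (mul_eq_zero.1 h).resolve_left (hne 0)
  | succ m ih =>
    have h := hrec (m + 1)
    rw [Nat.cast_succ (R := ℝ) m, ih, mul_zero, add_zero, ← Nat.cast_succ] at h
    exact (mul_eq_zero.1 h).resolve_left (hne (m + 1))

theorem integral_cosPowExp_neg (p t : ℝ) :
    ∫ x in (-1 / 2 : ℝ)..(1 / 2), cosPowExp p (-t) x
      = ∫ x in (-1 / 2 : ℝ)..(1 / 2), cosPowExp p t x := by
  have h := intervalIntegral.integral_comp_neg (a := -1 / 2) (b := 1 / 2) (cosPowExp p t)
  rw [show (-(-1 / 2) : ℝ) = 1 / 2 by norm_num, show (-(1 / 2) : ℝ) = -1 / 2 by norm_num] at h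
  rw [← h]
  refine intervalIntegral.integral_congr fun x _ => ?_
  simp [cosPowExp, expFun]

/-- Squaring doubles the exponent, and `2p > -1` makes it integrable. -/
theorem memLp_cosPowExp {p : ℝ} (hp : -1 / 2 < p) (t : ℝ) : MemLp (cosPowExp p t) 2 μI := by
  have hmeas : AEStronglyMeasurable (cosPowExp p t) μI := by
    unfold cosPowExp
    refine (Complex.measurable_ofReal.comp ?_).aestronglyMeasurable.mul
      (continuous_expFun t).aestronglyMeasurable
    exact (by fun_prop : Measurable fun x : ℝ => Real.cos (Real.pi * x)).pow_const p
  rw [memLp_two_iff_integrable_sq_norm hmeas]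
  have h := intervalIntegrable_cos_rpow (p := 2 * p) (by linarith)
  rw [intervalIntegrable_iff_integrableOn_Icc_of_le (by norm_num)] at h
  refine h.congr ?_
  filter_upwards [ae_restrict_mem measurableSet_Icc] with x hx
  have hx' : 0 ≤ Real.cos (Real.pi * x) :=
    Real.cos_nonneg_of_mem_Icc ⟨by nlinarith [hx.1, Real.pi_pos], by nlinarith [hx.2, Real.pi_pos]⟩
  rw [cosPowExp, norm_mul, norm_expFun, mul_one, Complex.norm_real, Real.norm_eq_abs, sq_abs,
    ← Real.rpow_natCast, ← Real.rpow_mul hx', mul_comm p, Nat.cast_ofNat]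

theorem inner_expVec_toLp_cosPowExp {p : ℝ} (hp : -1 / 2 < p) (s t : ℝ) :
    inner ℂ (expVec s) ((memLp_cosPowExp hp t).toLp _)
      = ∫ x in (-1 / 2 : ℝ)..(1 / 2), cosPowExp p (t - s) x := by
  rw [inner_expVec, intervalIntegral.integral_of_le (by norm_num),
    intervalIntegral.integral_of_le (by norm_num), ← integral_Icc_eq_integral_Ioc,
    ← integral_Icc_eq_integral_Ioc]
  refine integral_congr_ae ?_
  filter_upwards [(memLp_cosPowExp hp t).coeFn_toLp] with x hx
  rw [hx, cosPowExp, cosPowExp, sub_eq_add_neg, expFun_add]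
  ring

theorem not_isCompleteFamily_expSystem {ξ : ℝ} (hξ : ξ < -1 / 2) :
    ¬ IsCompleteFamily (expSystem ξ) := by
  intro hcomp
  have hp : -1 / 2 < -1 - ξ := by linarith
  have hp1 : -1 < -1 - ξ := by linarith
  set p := -1 - ξ with hpdef
  -- With `ξ = -1 - p`, pairing with index `n ≥ 0` leaves frequency `-(p/2 + n + 1)`, and with `n =
  -- -(m + 1)` leaves `p/2 + m + 1`: both are zeros of the integral.
  have h0 : (memLp_cosPowExp hp (-(p / 2 + 1))).toLp _ = 0 := by
    refine hcomp _ fun n => ?_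
    rcases le_or_gt 0 n with hn | hn
    · rw [expSystem_of_nonneg _ hn, inner_expVec_toLp_cosPowExp hp]
      obtain ⟨m, rfl⟩ := Int.eq_ofNat_of_zero_le hn
      rw [← integral_cosPowExp_eq_zero hp1 m, ← integral_cosPowExp_neg]
      push_cast
      ring_nf
    · rw [expSystem_of_neg _ hn, inner_expVec_toLp_cosPowExp hp]
      obtain ⟨m, hm⟩ := Int.eq_ofNat_of_zero_le (by omega : 0 ≤ -n - 1)
      have hm' : (n : ℝ) = -(m + 1) := by
        have : n = -(m + 1) := by omega
        rw [this]; push_cast; ring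
      rw [← integral_cosPowExp_eq_zero hp1 m, hm', hpdef]
      ring_nf
  rw [← norm_eq_zero, Lp.norm_toLp, ENNReal.toReal_eq_zero_iff] at h0
  have h1 := h0.resolve_right (memLp_cosPowExp hp _).2.ne
  rw [eLpNorm_eq_zero_iff (memLp_cosPowExp hp _).1 two_ne_zero, μI,
    ← restrict_Ioo_eq_restrict_Icc] at h1
  have h2 : ∀ᵐ x ∂(volume.restrict (Set.Ioo (-1 / 2 : ℝ) (1 / 2))), False := by
    filter_upwards [h1, ae_restrict_mem measurableSet_Ioo] with x hx hmem
    have h3 := congrArg norm hx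
    rw [cosPowExp, norm_mul, norm_expFun, mul_one, Complex.norm_real, Pi.zero_apply, norm_zero,
      norm_eq_zero] at h3
    exact (Real.rpow_pos_of_pos (cos_pi_mul_pos_of_mem hmem) p).ne' h3
  rw [Filter.eventually_false_iff_eq_bot, ae_eq_bot, Measure.restrict_eq_zero, Real.volume_Ioo] at h2
  norm_num at h2

/-- A frame at `-1/2` would persist slightly to the left, where completeness fails. A frame at a
later translate would descend, since the preceding system is complete. -/
theorem not_isFrame_expSystem_neg_half_add (n : ℕ) : ¬ IsFrame (expSystem (-1 / 2 + n)) := by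
  induction n with
  | zero =>
    rw [Nat.cast_zero, add_zero]
    intro h
    obtain ⟨δ, hδ, h⟩ := isFrame_expSystem_of_near h
    refine not_isCompleteFamily_expSystem (ξ := -1 / 2 - δ) (by linarith)
      (h _ ?_).isCompleteFamily
    rw [sub_sub_cancel_left, abs_neg, abs_of_pos hδ]
  | succ n ih =>
    rw [Nat.cast_succ, ← add_assoc]
    exact fun h => ih (isFrame_expSystem_of_add_one h (isCompleteFamily_expSystem_neg_half_add n))

end WindowedExp

end

/-! ### The four cases -/

theorem mainTheorem2 (ξ : ℝ) :
    (ξ < -1 / 2 → ¬ WindowedExp.IsCompleteFamily (WindowedExp.expSystem ξ)) ∧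
    (-1 / 2 < ξ → ξ < 1 / 2 → WindowedExp.IsRieszBasis (WindowedExp.expSystem ξ)) ∧
    (∀ n : ℕ, 1 ≤ n → -1 / 2 + (n : ℝ) < ξ → ξ < 1 / 2 + (n : ℝ) →
      WindowedExp.IsFrame (WindowedExp.expSystem ξ) ∧
      ¬ WindowedExp.IsRieszBasis (WindowedExp.expSystem ξ)) ∧
    (∀ n : ℕ, ξ = -1 / 2 + (n : ℝ) →
      WindowedExp.IsCompleteFamily (WindowedExp.expSystem ξ) ∧
      ¬ WindowedExp.IsFrame (WindowedExp.expSystem ξ) ∧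
      ¬ WindowedExp.IsRieszBasis (WindowedExp.expSystem ξ)) := by
  refine ⟨WindowedExp.not_isCompleteFamily_expSystem, fun h1 h2 => ?_, fun n hn h1 h2 => ?_, ?_⟩
  · exact WindowedExp.isRieszBasis_expSystem (abs_lt.2 ⟨by linarith, h2⟩)
  · obtain ⟨m, rfl⟩ := Nat.exists_eq_add_of_le' hn
    -- The last unit translation is kept apart: it is the one that contradicts uniqueness, while the
    -- first `m` preserve existence of expansions.
    obtain ⟨η, rfl⟩ : ∃ η, ξ = η + m + 1 := ⟨ξ - m - 1, by ring⟩
    push_cast at h1 h2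
    have hη : |η| < 1 / 2 := abs_lt.2 ⟨by linarith, by linarith⟩
    obtain ⟨hf, he⟩ := WindowedExp.isFrame_and_exists_hasSum_expSystem m hη
    exact ⟨WindowedExp.isFrame_expSystem_add_one hf,
      WindowedExp.not_isRieszBasis_expSystem_add_one he⟩
  · rintro n rfl
    have h := WindowedExp.not_isFrame_expSystem_neg_half_add n
    exact ⟨WindowedExp.isCompleteFamily_expSystem_neg_half_add n, h, fun hR => h hR.1⟩
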